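/- Let $G$ be a connected finite simple graph of order $n$ (so $n\ge 1$). Let $s^+(G)$ denote the sum of the squares of the positive eigenvalues, counted with multiplicity, of the adjacency matrix of $G$, and let $\gamma(G)$ be the domination number of $G$, i.e. the minimum size of a set $D\subseteq V(G)$ such that every vertex outside $D$ has a neighbour in $D$. Call a vertex dominating if it is adjacent to all other vertices. (i) If $G$ has a dominating vertex and $G$ is not isomorphic to the star $K_{1,n-1}$ (where $K_{1,0}=K_1$), then $s^+(G)\ge n$. (ii) If $\gamma(G)\le 2$, then $s^+(G)\ge n-1$. -/

import Mathlib

namespace SimpleGraph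

variable {V : Type*}

/-- A vertex adjacent to every other vertex. -/
def IsDominatingVertex (G : SimpleGraph V) (v : V) : Prop :=
  ∀ w, w ≠ v → G.Adj v w

/-- A set of vertices such that every vertex outside it has a neighbour in it. -/
def IsDominatingSet (G : SimpleGraph V) (D : Finset V) : Prop :=
  ∀ w, w ∉ D → ∃ v ∈ D, G.Adj v w

/-- The domination number `γ(G)` of a finite graph: the least size of a dominating set
(the whole vertex set is dominating, so the infimum is attained). -/
noncomputable def dominationNumber [Fintype V] (G : SimpleGraph V) : ℕ :=
  sInf {k | ∃ D : Finset V, G.IsDominatingSet D ∧ D.card = k}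

/-- The positive square energy `s⁺(G)`: the sum of the squares of the positive eigenvalues of the
adjacency matrix, counted with multiplicity. -/
noncomputable def posSquareEnergy [Fintype V] [DecidableEq V] (G : SimpleGraph V)
    [DecidableRel G.Adj] : ℝ :=
  ∑ i : V with 0 < (G.isHermitian_adjMatrix ℝ).eigenvalues i,
    (G.isHermitian_adjMatrix ℝ).eigenvalues i ^ 2

end SimpleGraph

/-! ### The variational formula for the positive square energy -/

namespace Matrix

/-! Every positive semidefinite `X` gives the lower bound `2⟨A, X⟩ - ‖X‖² ≤ s⁺(G)`
(`gain_le_sum_sq_eigenvalues`), so the proof consists in choosing certificates `X`. The positive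
part of a bipartite graph `H` with `m` edges has gain `m` against `H`. Used in a larger graph, it
gains more from extra edges at positive entries and loses only at negative ones. Certificates with
disjoint supports add up (`HasGain.union`), and a certificate that is small on an edge can be
improved there (`exists_gain_add_edge`).

The positive part of a star is entrywise nonnegative, which gives `n - 1` for a dominating vertex.
An edge `xy` between leaves adds at least 1, which is (i). For two adjacent dominating vertices, a
spanning double star works in the same way.

Let the dominating vertices `u`, `v` be nonadjacent, with sets `P`, `Q` of private neighbours and
`R` of common ones, of sizes `p`, `q`, `r`; then `n - 1 = p + q + r + 1`. If `P` or `Q` is empty,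
two adjacent vertices dominate as well. If `P` or `Q` contains an edge, two disjoint stars suffice.
Otherwise let `e` count the edges between `P` and `Q`. If `e > r`, the induced bipartite graph on
`{u, v} ∪ P ∪ Q` has enough edges. If `e ≤ r`, connectivity forces `r ≥ 1`, and the bipartite graph
joining `u`, `v` to their neighbours has `p + q + 2r` edges. The only negative entries of its
positive part are between `P` and `Q`, and the resulting loss is affordable, after one edge
improvement when `r = e = 1`. -/

theorem PosSemidef.apply_comm {V : Type*} {X : Matrix V V ℝ} (hX : X.PosSemidef) (i j : V) :
    X i j = X j i := by
  simpa using (hX.isHermitian.apply j i)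

variable {V : Type*} [Fintype V]

/-- The functional `2 ⟨A, X⟩ - ‖X‖²` for the Frobenius inner product. Its maximum over positive
semidefinite `X` is the sum of the squares of the positive eigenvalues of `A`. -/
def gain (A X : Matrix V V ℝ) : ℝ :=
  ∑ i, ∑ j, (2 * A i j * X i j - X i j ^ 2)

open scoped MatrixOrder in
theorem PosSemidef.trace_mul_nonneg_of_real {A B : Matrix V V ℝ} (hA : A.PosSemidef)
    (hB : B.PosSemidef) : 0 ≤ (A * B).trace := by
  classical
  obtain ⟨C, rfl⟩ := CStarAlgebra.nonneg_iff_eq_star_mul_self.mp hA.nonneg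
  rw [Matrix.mul_assoc, Matrix.trace_mul_comm]
  exact (hB.mul_mul_conjTranspose_same C).trace_nonneg

theorem gain_eq_trace (A : Matrix V V ℝ) {X : Matrix V V ℝ} (hX : X.PosSemidef) :
    gain A X = 2 * (A * X).trace - (X * X).trace := by
  simp only [gain, Matrix.trace, Matrix.diag, Matrix.mul_apply, Finset.mul_sum,
    ← Finset.sum_sub_distrib]
  refine Finset.sum_congr rfl fun i _ => Finset.sum_congr rfl fun j _ => ?_
  rw [hX.apply_comm j i]
  ring

variable [DecidableEq V]

/-- The decomposition of a real symmetric matrix into its positive and negative parts. -/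
theorem IsHermitian.exists_posSemidef_sub {A : Matrix V V ℝ} (hA : A.IsHermitian) :
    ∃ P N : Matrix V V ℝ, P.PosSemidef ∧ N.PosSemidef ∧ A = P - N ∧ P * N = 0 ∧ N * P = 0 ∧
      (P * P).trace = ∑ i with 0 < hA.eigenvalues i, hA.eigenvalues i ^ 2 := by
  set U : Matrix V V ℝ := (hA.eigenvectorUnitary : Matrix V V ℝ) with hU
  have hUU : Uᴴ * U = 1 := Unitary.coe_star_mul_self hA.eigenvectorUnitary
  set l := hA.eigenvalues
  have hmul : ∀ d e : V → ℝ, (U * diagonal d * Uᴴ) * (U * diagonal e * Uᴴ) =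
      U * diagonal (fun i => d i * e i) * Uᴴ := by
    intro d e
    calc _ = U * diagonal d * (Uᴴ * U) * diagonal e * Uᴴ := by simp only [Matrix.mul_assoc]
      _ = _ := by rw [hUU, Matrix.mul_one, Matrix.mul_assoc U, diagonal_mul_diagonal]
  have hpsd : ∀ d : V → ℝ, 0 ≤ d → (U * diagonal d * Uᴴ).PosSemidef := fun d hd =>
    (PosSemidef.diagonal hd).mul_mul_conjTranspose_same U
  have hzero : ∀ i, max (l i) 0 * max (-l i) 0 = 0 := by
    intro i
    rcases le_total 0 (l i) with h | h
    · rw [max_eq_right (neg_nonpos.mpr h), mul_zero]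
    · rw [max_eq_right h, zero_mul]
  refine ⟨U * diagonal (fun i => max (l i) 0) * Uᴴ, U * diagonal (fun i => max (-l i) 0) * Uᴴ,
    hpsd _ fun i => le_max_right _ _, hpsd _ fun i => le_max_right _ _, ?_, ?_, ?_, ?_⟩
  · rw [← Matrix.sub_mul, ← Matrix.mul_sub, diagonal_sub]
    have h : (fun i => max (l i) 0 - max (-l i) 0) = l := by
      ext i
      rcases le_total 0 (l i) with h | h
      · simp [h]
      · simp [h]
    rw [h]
    have := hA.spectral_theorem
    rw [Unitary.conjStarAlgAut_apply] at this
    exact this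
  · rw [hmul]; simp [hzero]
  · rw [hmul]; simp [mul_comm _ (max (l _) 0), hzero]
  · rw [hmul, Matrix.trace_mul_comm, ← Matrix.mul_assoc, hUU, Matrix.one_mul, trace_diagonal,
      Finset.sum_filter]
    refine Finset.sum_congr rfl fun i _ => ?_
    split_ifs with h
    · rw [max_eq_left h.le, sq]
    · rw [max_eq_right (not_lt.mp h), mul_zero]

/-- With `A = P - N`, dropping `⟨N, X⟩ ≥ 0` leaves `2⟨P, X⟩ - ‖X‖² = ‖P‖² - ‖P - X‖²`. -/
theorem gain_le_sum_sq_eigenvalues {A X : Matrix V V ℝ} (hA : A.IsHermitian)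
    (hX : X.PosSemidef) :
    gain A X ≤ ∑ i with 0 < hA.eigenvalues i, hA.eigenvalues i ^ 2 := by
  obtain ⟨P, N, hP, hN, hPN, -, -, htr⟩ := hA.exists_posSemidef_sub
  rw [← htr, gain_eq_trace _ hX]
  have h1 : 0 ≤ (N * X).trace := hN.trace_mul_nonneg_of_real hX
  have h2 : 0 ≤ ((P - X) * (P - X)).trace := by
    have h := (posSemidef_conjTranspose_mul_self (P - X)).trace_nonneg
    rwa [(hP.isHermitian.sub hX.isHermitian).eq] at h
  have h3 : (A * X).trace = (P * X).trace - (N * X).trace := by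
    rw [hPN, Matrix.sub_mul, Matrix.trace_sub]
  have h4 : ((P - X) * (P - X)).trace =
      (P * P).trace - 2 * (P * X).trace + (X * X).trace := by
    simp only [Matrix.sub_mul, Matrix.mul_sub, Matrix.trace_sub, Matrix.trace_mul_comm X P]
    ring
  linarith

/-- A symmetric matrix whose support is bipartite has half of its squared Frobenius norm on the
positive side. -/
theorem IsHermitian.exists_gain_of_bipartite {A : Matrix V V ℝ} (hA : A.IsHermitian) (ε : V → ℝ)
    (hε : ∀ i, ε i * ε i = 1) (hAε : ∀ i j, ε i * A i j * ε j = -A i j) :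
    ∃ X : Matrix V V ℝ, X.PosSemidef ∧ (A * A).trace / 2 ≤ gain A X := by
  obtain ⟨P, N, hP, hN, hPN, h0, h0', -⟩ := hA.exists_posSemidef_sub
  set D := diagonal ε
  have hD : Dᴴ = D := by simp [D]
  have hDD : D * D = 1 := by simp [D, diagonal_mul_diagonal, hε]
  have hDA : D * A * D = -A := by
    ext i j; simp [D, diagonal_mul, mul_diagonal, hAε]
  -- Conjugation by the signs turns `A` into `-A`, so `D * N * D` gains `‖N‖²` just as `P` gains
  -- `‖P‖²`. These sum to `‖A‖²`, so the better of the two suffices.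
  have hY : (D * N * D).PosSemidef := by
    have := hN.mul_mul_conjTranspose_same D
    rwa [hD] at this
  have g1 : gain A P = (P * P).trace := by
    rw [gain_eq_trace _ hP, hPN, Matrix.sub_mul, h0', sub_zero]; ring
  have g2 : gain A (D * N * D) = (N * N).trace := by
    rw [gain_eq_trace _ hY]
    have e1 : (A * (D * N * D)).trace = (N * N).trace := by
      calc (A * (D * N * D)).trace = ((A * D * N) * D).trace := by simp only [Matrix.mul_assoc]
        _ = ((D * A * D) * N).trace := by
          rw [Matrix.trace_mul_comm]; simp only [Matrix.mul_assoc]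
        _ = _ := by rw [hDA, hPN]; simp [Matrix.sub_mul, h0]
    have e2 : (D * N * D) * (D * N * D) = D * (N * N) * D := by
      calc _ = D * N * (D * D) * N * D := by simp only [Matrix.mul_assoc]
        _ = _ := by rw [hDD, Matrix.mul_one]; simp only [Matrix.mul_assoc]
    have e3 : (D * (N * N) * D).trace = (N * N).trace := by
      rw [Matrix.trace_mul_comm, ← Matrix.mul_assoc, hDD, Matrix.one_mul]
    rw [e1, e2, e3]; ring
  have g3 : (A * A).trace = (P * P).trace + (N * N).trace := by
    rw [hPN]; simp [Matrix.sub_mul, Matrix.mul_sub, h0, h0']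
  rcases le_total ((N * N).trace) ((P * P).trace) with h | h
  · exact ⟨P, hP, by rw [g1, g3]; linarith⟩
  · exact ⟨D * N * D, hY, by rw [g2, g3]; linarith⟩

end Matrix

/-! ### Sums of certificates and block-constant certificates -/

namespace Matrix

variable {V : Type*} [Fintype V]

theorem gain_add (A X Y : Matrix V V ℝ) :
    gain A (X + Y) = gain A X + gain A Y - 2 * ∑ i, ∑ j, X i j * Y i j := by
  simp only [gain, Finset.mul_sum, ← Finset.sum_add_distrib, ← Finset.sum_sub_distrib]
  refine Finset.sum_congr rfl fun i _ => Finset.sum_congr rfl fun j _ => ?_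
  rw [add_apply]
  ring

theorem posSemidef_smul_vecMulVec_self {ι : Type*} [Finite ι] {w : ℝ} (hw : 0 ≤ w) (z : ι → ℝ) :
    (w • vecMulVec z z).PosSemidef := by
  have := Fintype.ofFinite ι
  have h := posSemidef_vecMulVec_self_star z
  rw [star_trivial] at h
  exact h.smul hw

theorem sum_sum_comp {ι : Type*} [Fintype ι] [DecidableEq ι] (κ : V → ι) (n : ι → ℝ)
    (hn : ∀ a, (Finset.card {i | κ i = a} : ℝ) = n a) (g : ι → ι → ℝ) :
    ∑ i, ∑ j, g (κ i) (κ j) = ∑ a, ∑ a', n a * n a' * g a a' := by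
  have hsum : ∀ f : ι → ℝ, ∑ i, f (κ i) = ∑ a, n a * f a := by
    intro f
    rw [← Finset.sum_fiberwise Finset.univ κ]
    refine Finset.sum_congr rfl fun a _ => ?_
    rw [Finset.sum_congr rfl (g := fun _ => f a) (by simp +contextual), Finset.sum_const,
      nsmul_eq_mul, hn]
  rw [hsum fun a => ∑ j, g a (κ j)]
  refine Finset.sum_congr rfl fun a _ => ?_
  rw [hsum, Finset.mul_sum]
  exact Finset.sum_congr rfl fun a' _ => by ring

/-- A lower bound for the gain of a matrix that is constant on the blocks of a partition. -/
theorem le_gain_submatrix {ι : Type*} [Fintype ι] [DecidableEq ι] (A : Matrix V V ℝ) (κ : V → ι)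
    (x b : Matrix ι ι ℝ) (c : V → V → ℝ) (n : ι → ℝ)
    (hn : ∀ a, (Finset.card {i | κ i = a} : ℝ) = n a)
    -- `b` records the edges that are guaranteed between blocks, `c` those that have to be counted
    -- one by one.
    (hb : ∀ i j, b (κ i) (κ j) + c i j ≤ A i j * x (κ i) (κ j)) :
    ∑ a, ∑ a', n a * n a' * (2 * b a a' - x a a' ^ 2) + 2 * ∑ i, ∑ j, c i j ≤
      gain A (x.submatrix κ κ) := by
  rw [← sum_sum_comp κ n hn fun a a' => 2 * b a a' - x a a' ^ 2, Finset.mul_sum,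
    ← Finset.sum_add_distrib]
  refine Finset.sum_le_sum fun i _ => ?_
  rw [Finset.mul_sum, ← Finset.sum_add_distrib]
  refine Finset.sum_le_sum fun j _ => ?_
  have := hb i j
  simp only [submatrix_apply]
  linarith

end Matrix

/-! ### Certificates in a graph -/

namespace SimpleGraph

open Matrix

variable {V : Type*} [Fintype V] [DecidableEq V] (G : SimpleGraph V) [DecidableRel G.Adj]

/-- There is a positive semidefinite matrix supported on `S` that certifies a contribution of at
least `c` of `S` to the positive square energy of `G`. -/
def HasGain (S : Finset V) (c : ℝ) : Prop :=
  ∃ X : Matrix V V ℝ, X.PosSemidef ∧ (∀ i j, i ∉ S → X i j = 0) ∧ c ≤ gain (G.adjMatrix ℝ) X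

variable {G}

theorem gain_le_posSquareEnergy {X : Matrix V V ℝ} (hX : X.PosSemidef) :
    gain (G.adjMatrix ℝ) X ≤ G.posSquareEnergy :=
  gain_le_sum_sq_eigenvalues (G.isHermitian_adjMatrix ℝ) hX

theorem HasGain.le_posSquareEnergy {S : Finset V} {c : ℝ} (h : G.HasGain S c) :
    c ≤ G.posSquareEnergy := by
  obtain ⟨X, hX, -, hc⟩ := h
  exact hc.trans (gain_le_posSquareEnergy hX)

theorem HasGain.union {S T : Finset V} {c d : ℝ} (hS : G.HasGain S c) (hT : G.HasGain T d)
    (hST : Disjoint S T) : G.HasGain (S ∪ T) (c + d) := by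
  obtain ⟨X, hX, hXS, hc⟩ := hS
  obtain ⟨Y, hY, hYT, hd⟩ := hT
  refine ⟨X + Y, hX.add hY, fun i j hi => ?_, ?_⟩
  · rw [Finset.mem_union, not_or] at hi
    rw [Matrix.add_apply, hXS i j hi.1, hYT i j hi.2, add_zero]
  · have h0 : ∑ i, ∑ j, X i j * Y i j = 0 := by
      refine Finset.sum_eq_zero fun i _ => Finset.sum_eq_zero fun j _ => ?_
      by_cases hi : i ∈ S
      · rw [hYT i j (Finset.disjoint_left.mp hST hi), mul_zero]
      · rw [hXS i j hi, zero_mul]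
    rw [gain_add, h0]
    linarith

/-- Improving a certificate along an edge on which it is small. -/
theorem exists_gain_add_edge {X : Matrix V V ℝ} (hX : X.PosSemidef) {x y : V} (hxy : G.Adj x y)
    {t : ℝ} (ht : 0 ≤ t) (hXt : X x x + X y y + 2 * X x y = 2 - 2 * t) :
    ∃ Y : Matrix V V ℝ, Y.PosSemidef ∧ (∀ i j, i ≠ x → i ≠ y → Y i j = X i j) ∧
      gain (G.adjMatrix ℝ) X + t ^ 2 = gain (G.adjMatrix ℝ) Y := by
  -- Adding `α • vecMulVec w w` changes the gain by `4αt - 4α²`, which is largest at `α = t / 2`.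
  set w : V → ℝ := Pi.single x 1 + Pi.single y 1 with hw
  refine ⟨X + (t / 2) • vecMulVec w w,
    hX.add (posSemidef_smul_vecMulVec_self (by positivity) w), fun i j hx hy => ?_, ?_⟩
  · simp [hw, vecMulVec_apply, hx, hy]
  · have hne := hxy.ne
    have key : ∀ Z : Matrix V V ℝ, ∑ i, ∑ j, Z i j * (w i * w j) =
        Z x x + Z x y + (Z y x + Z y y) := by
      intro Z
      have h1 : ∀ g : V → ℝ, ∑ i, g i * w i = g x + g y := by
        intro g
        simp [hw, mul_add, Finset.sum_add_distrib, Pi.single_apply]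
      calc _ = ∑ i, (∑ j, Z i j * w j) * w i := by
            refine Finset.sum_congr rfl fun i _ => ?_
            rw [Finset.sum_mul]
            exact Finset.sum_congr rfl fun j _ => by ring
        _ = _ := by rw [h1]; simp only [h1]
    have hA := key (G.adjMatrix ℝ)
    have hXX := key X
    have hW := key (vecMulVec w w)
    have e1 : gain (G.adjMatrix ℝ) ((t / 2) • vecMulVec w w) =
        t * ∑ i, ∑ j, G.adjMatrix ℝ i j * (w i * w j) -
          t ^ 2 / 4 * ∑ i, ∑ j, vecMulVec w w i j * (w i * w j) := by
      simp only [gain, Finset.mul_sum, ← Finset.sum_sub_distrib]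
      refine Finset.sum_congr rfl fun i _ => Finset.sum_congr rfl fun j _ => ?_
      simp only [Matrix.smul_apply, vecMulVec_apply, smul_eq_mul]
      ring
    have e2 : ∑ i, ∑ j, X i j * ((t / 2) • vecMulVec w w) i j =
        t / 2 * ∑ i, ∑ j, X i j * (w i * w j) := by
      simp only [Finset.mul_sum]
      refine Finset.sum_congr rfl fun i _ => Finset.sum_congr rfl fun j _ => ?_
      simp only [Matrix.smul_apply, vecMulVec_apply, smul_eq_mul]
      ring
    rw [gain_add, e1, e2, hA, hXX, hW, hX.apply_comm y x]
    simp [hw, vecMulVec_apply, hxy, hxy.symm, hne, hne.symm]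
    linear_combination t * hXt

/-- An induced bipartite subgraph contributes its number of edges. -/
theorem hasGain_of_bipartite (S : Finset V) (ε : V → ℝ) (hε : ∀ i, ε i * ε i = 1)
    (hS : ∀ i ∈ S, ∀ j ∈ S, G.Adj i j → ε i * ε j = -1) :
    G.HasGain S ((∑ i ∈ S, ∑ j ∈ S, G.adjMatrix ℝ i j) / 2) := by
  set e : V → ℝ := fun i => if i ∈ S then 1 else 0 with he
  set B : Matrix V V ℝ := of fun i j => e i * G.adjMatrix ℝ i j * e j with hB
  have hBh : B.IsHermitian := by
    ext i j
    simp only [hB, conjTranspose_apply, of_apply, star_trivial, adjMatrix_apply, G.adj_comm j i]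
    ring
  obtain ⟨X, hX, hg⟩ := hBh.exists_gain_of_bipartite ε hε (by
    intro i j
    by_cases hi : i ∈ S <;> by_cases hj : j ∈ S <;> by_cases h : G.Adj i j <;>
      simp [hB, he, hi, hj, h]
    exact hS i hi j hj h)
  refine ⟨diagonal e * X * diagonal e, ?_, ?_, ?_⟩
  · have := hX.mul_mul_conjTranspose_same (diagonal e)
    simpa using this
  · intro i j hi
    simp [diagonal_mul, mul_diagonal, he, hi]
  · have h1 : (B * B).trace = ∑ i ∈ S, ∑ j ∈ S, G.adjMatrix ℝ i j := by
      simp only [Matrix.trace, Matrix.diag, Matrix.mul_apply]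
      rw [← Finset.sum_filter_add_sum_filter_not Finset.univ (· ∈ S),
        Finset.sum_eq_zero (s := Finset.univ.filter (¬ · ∈ S)), add_zero, Finset.filter_univ_mem]
      · refine Finset.sum_congr rfl fun i hi => ?_
        rw [← Finset.sum_filter_add_sum_filter_not Finset.univ (· ∈ S),
          Finset.sum_eq_zero (s := Finset.univ.filter (¬ · ∈ S)), add_zero, Finset.filter_univ_mem]
        · refine Finset.sum_congr rfl fun j hj => ?_
          simp [hB, he, hi, hj, G.adj_comm j i]
        · intro j hj
          simp [hB, he, (Finset.mem_filter.mp hj).2]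
      · intro i hi
        simp [hB, he, (Finset.mem_filter.mp hi).2]
    rw [← h1]
    -- Inside `S` the summands agree; elsewhere the left one is minus a square and the right one is
    -- zero.
    refine hg.trans ?_
    refine Finset.sum_le_sum fun i _ => Finset.sum_le_sum fun j _ => ?_
    by_cases hi : i ∈ S <;> by_cases hj : j ∈ S <;>
      simp [hB, he, hi, hj, diagonal_mul, mul_diagonal, sq_nonneg]

end SimpleGraph

/-! ### Stars -/

namespace SimpleGraph

open Matrix

variable {V : Type*} [Fintype V] [DecidableEq V] {G : SimpleGraph V} [DecidableRel G.Adj]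

theorem adjMatrix_nonneg {V : Type*} {G : SimpleGraph V} [DecidableRel G.Adj] (i j : V) : 0 ≤ G.adjMatrix ℝ i j := by
  rw [adjMatrix_apply]
  split_ifs <;> norm_num

/-- The certificate is the positive part of the star: its only positive eigenvalue is `√S.card`,
with an eigenvector constant on the leaves. Edges between leaves meet positive entries, hence the
extra term. -/
theorem exists_gain_of_star {v : V} {S : Finset V} (hv : v ∉ S) (hadj : ∀ w ∈ S, G.Adj v w)
    (hS : S.Nonempty) :
    ∃ X : Matrix V V ℝ, X.PosSemidef ∧ (∀ i j, i ∉ insert v S → X i j = 0) ∧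
      (∀ i ∈ S, ∀ j ∈ S, X i j = 1 / (2 * √S.card)) ∧
      S.card + (∑ i ∈ S, ∑ j ∈ S, G.adjMatrix ℝ i j) / √S.card ≤ gain (G.adjMatrix ℝ) X := by
  set s : ℝ := √S.card with hs
  have hpos : 0 < s := Real.sqrt_pos.mpr (by exact_mod_cast hS.card_pos)
  have hss : s ^ 2 = S.card := Real.sq_sqrt (Nat.cast_nonneg _)
  set κ : V → Fin 3 := fun i => if i = v then 0 else if i ∈ S then 1 else 2 with hκ
  have hκ0 : ∀ i, κ i = 0 ↔ i = v := by
    intro i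
    by_cases h1 : i = v <;> by_cases h2 : i ∈ S <;> simp [hκ, h1, h2]
  have hκ1 : ∀ i, κ i = 1 ↔ i ∈ S := by
    intro i
    by_cases h1 : i = v
    · subst h1
      simp [hκ, hv]
    · by_cases h2 : i ∈ S <;> simp [hκ, h1, h2]
  set x : Matrix (Fin 3) (Fin 3) ℝ :=
    !![s / 2, 1 / 2, 0; 1 / 2, 1 / (2 * s), 0; 0, 0, 0] with hx
  have hxpsd : x.PosSemidef := by
    have : x = (s / 2) • vecMulVec ![1, 1 / s, 0] ![1, 1 / s, 0] := by
      ext a b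
      fin_cases a <;> fin_cases b <;> simp [hx] <;> field_simp
    rw [this]
    exact posSemidef_smul_vecMulVec_self (by positivity) _
  refine ⟨x.submatrix κ κ, hxpsd.submatrix κ, ?_, ?_, ?_⟩
  · intro i j hi
    rw [Finset.mem_insert, not_or] at hi
    have h2 : κ i = 2 := by simp [hκ, hi]
    rw [submatrix_apply, h2]
    generalize κ j = b
    fin_cases b <;> simp [hx]
  · intro i hi j hj
    rw [submatrix_apply, (hκ1 i).mpr hi, (hκ1 j).mpr hj]
    simp [hx]
  · have hn : ∀ a, (Finset.card {i | κ i = a} : ℝ) =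
        ![1, s ^ 2, (Finset.card {i | κ i = 2} : ℝ)] a := by
      intro a
      fin_cases a
      · simp [hκ0, Finset.filter_eq']
      · simp [hκ1, hss]
      · simp
    have h := le_gain_submatrix (G.adjMatrix ℝ) κ x
      !![0, 1 / 2, 0; 1 / 2, 0, 0; 0, 0, 0]
      (fun i j => if κ i = 1 then if κ j = 1 then G.adjMatrix ℝ i j / (2 * s) else 0 else 0)
      _ hn (by
        intro i j
        have h01 : κ i = 0 → κ j = 1 → G.adjMatrix ℝ i j = 1 := by
          intro h0 h1
          rw [hκ0] at h0
          simp [h0, hadj j ((hκ1 j).mp h1)]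
        have h10 : κ i = 1 → κ j = 0 → G.adjMatrix ℝ i j = 1 := by
          intro h1 h0
          rw [hκ0] at h0
          simp [h0, (hadj i ((hκ1 i).mp h1)).symm]
        have hA := adjMatrix_nonneg (G := G) i j
        revert h01 h10 hA
        generalize G.adjMatrix ℝ i j = α
        generalize κ i = a
        generalize κ j = b
        intro h01 h10 hA
        fin_cases a <;> fin_cases b <;> simp [hx] at h01 h10 ⊢
        all_goals first | positivity | (subst_vars; norm_num; done) | exact le_of_eq (by field_simp))
    have hc : ∑ i, ∑ j, (if κ i = 1 then if κ j = 1 then G.adjMatrix ℝ i j / (2 * s) else 0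
        else 0) = (∑ i ∈ S, ∑ j ∈ S, G.adjMatrix ℝ i j) / (2 * s) := by
      generalize G.adjMatrix ℝ = A
      simp only [Finset.sum_div]
      rw [← Finset.sum_filter_add_sum_filter_not Finset.univ (· ∈ S),
        Finset.sum_eq_zero (s := Finset.univ.filter (¬ · ∈ S)), add_zero, Finset.filter_univ_mem]
      · refine Finset.sum_congr rfl fun i hi => ?_
        simp [hκ1, hi]
      · intro i hi
        simp [hκ1, (Finset.mem_filter.mp hi).2]
    rw [hc] at h
    refine le_trans (le_of_eq ?_) h
    simp [Fin.sum_univ_three, hx]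
    field_simp
    linear_combination (-4 * s) * hss

theorem hasGain_star {v : V} {S : Finset V} (hv : v ∉ S) (hadj : ∀ w ∈ S, G.Adj v w) :
    G.HasGain (insert v S) S.card := by
  rcases S.eq_empty_or_nonempty with rfl | hS
  · exact ⟨0, .zero, fun _ _ _ => rfl, by simp [gain]⟩
  · obtain ⟨X, hX, hXS, -, hg⟩ := exists_gain_of_star hv hadj hS
    refine ⟨X, hX, hXS, le_trans ?_ hg⟩
    have : 0 ≤ ∑ i ∈ S, ∑ j ∈ S, G.adjMatrix ℝ i j :=
      Finset.sum_nonneg fun i _ => Finset.sum_nonneg fun j _ => adjMatrix_nonneg i j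
    have : 0 ≤ (∑ i ∈ S, ∑ j ∈ S, G.adjMatrix ℝ i j) / √S.card := by positivity
    linarith

/-- With `s = √S.card`, the edge `xy` brings `2 / s` in the star certificate, and improving along it
brings `(1 - 1 / s) ^ 2`. Together this is `1 + 1 / s ^ 2`. -/
theorem hasGain_star_of_adj {v : V} {S : Finset V} (hv : v ∉ S) (hadj : ∀ w ∈ S, G.Adj v w)
    {x y : V} (hx : x ∈ S) (hy : y ∈ S) (hxy : G.Adj x y) :
    G.HasGain (insert v S) (S.card + 1) := by
  obtain ⟨X, hX, hXS, hX', hg⟩ := exists_gain_of_star hv hadj ⟨x, hx⟩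
  have hcard : (1 : ℝ) ≤ S.card := by
    exact_mod_cast Finset.card_pos.mpr ⟨x, hx⟩
  set s : ℝ := √S.card with hs
  have hs1 : 1 ≤ s := Real.one_le_sqrt.mpr hcard
  have hss : s ^ 2 = S.card := Real.sq_sqrt (Nat.cast_nonneg _)
  have hs0 : 1 / s ≤ 1 := by rw [div_le_one (by linarith)]; exact hs1
  obtain ⟨Y, hY, hYX, hYg⟩ := exists_gain_add_edge hX hxy (t := 1 - 1 / s) (by linarith) (by
    rw [hX' x hx x hx, hX' y hy y hy, hX' x hx y hy]
    field_simp
    ring)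
  refine ⟨Y, hY, fun i j hi => ?_, ?_⟩
  · have hi' := fun h => hi (Finset.mem_insert_of_mem h)
    rw [hYX i j (fun h => hi' (h ▸ hx)) (fun h => hi' (h ▸ hy)), hXS i j hi]
  · have h2 : 2 ≤ ∑ i ∈ S, ∑ j ∈ S, G.adjMatrix ℝ i j := by
      rw [← Finset.sum_product' S S fun i j => G.adjMatrix ℝ i j]
      calc (2 : ℝ) = ∑ p ∈ {(x, y), (y, x)}, G.adjMatrix ℝ p.1 p.2 := by
            rw [Finset.sum_pair (by simp [hxy.ne])]
            simp [hxy, hxy.symm]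
            norm_num
        _ ≤ _ := by
            refine Finset.sum_le_sum_of_subset_of_nonneg ?_ fun p _ _ => adjMatrix_nonneg p.1 p.2
            simp [Finset.insert_subset_iff, hx, hy]
    rw [← hYg]
    have h3 : 2 / s ≤ (∑ i ∈ S, ∑ j ∈ S, G.adjMatrix ℝ i j) / s := by gcongr
    have h4 : (1 - 1 / s) ^ 2 = 1 - 2 / s + (1 / s) ^ 2 := by ring
    have h5 : 0 ≤ (1 / s) ^ 2 := sq_nonneg _
    linarith

end SimpleGraph

/-! ### Two adjacent dominating vertices -/

namespace SimpleGraph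

open Matrix

variable {V : Type*} [Fintype V] [DecidableEq V] {G : SimpleGraph V} [DecidableRel G.Adj]

theorem card_eq_sum_card_fiber {V ι : Type*} [Fintype V] [Fintype ι] [DecidableEq ι] (κ : V → ι) (n : ι → ℝ)
    (hn : ∀ a, (Finset.card {i | κ i = a} : ℝ) = n a) : (Fintype.card V : ℝ) = ∑ a, n a := by
  rw [← Finset.card_univ, Finset.card_eq_sum_card_fiberwise (f := κ) (t := Finset.univ) (by simp)]
  simp [hn]

/-- Two adjacent vertices that dominate the graph span a double star, whose positive part has
nonnegative entries. -/
theorem card_sub_one_le_of_adj {u v : V} (huv : G.Adj u v)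
    (hdom : ∀ w, w ≠ u → w ≠ v → G.Adj u w ∨ G.Adj v w)
    (hP : ∃ w, w ≠ v ∧ G.Adj u w) (hQ : ∃ w, w ≠ u ∧ ¬ G.Adj u w) :
    (Fintype.card V : ℝ) - 1 ≤ G.posSquareEnergy := by
  -- Common neighbours are made leaves of `u`, so that the double star is a spanning tree.
  set κ : V → Fin 4 := fun i => if i = u then 0 else if i = v then 1 else
    if G.Adj u i then 2 else 3 with hκ
  have hne := huv.ne
  have hκ0 : ∀ i, κ i = 0 ↔ i = u := by
    intro i
    simp only [hκ]
    split_ifs <;> simp_all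
  have hκ1 : ∀ i, κ i = 1 ↔ i = v := by
    intro i
    simp only [hκ]
    split_ifs <;> simp_all
  have hκ2 : ∀ i, κ i = 2 ↔ i ≠ v ∧ G.Adj u i := by
    intro i
    simp only [hκ]
    split_ifs <;> simp_all
  have hκ3 : ∀ i, κ i = 3 ↔ i ≠ u ∧ ¬ G.Adj u i := by
    intro i
    simp only [hκ]
    split_ifs <;> simp_all
  have hpos : ∀ k w, κ w = k → 0 < (Finset.card {i | κ i = k} : ℝ) := by
    intro k w hw
    exact_mod_cast Finset.card_pos.mpr ⟨w, by simpa using hw⟩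
  have hp0 : 0 < (Finset.card {i | κ i = 2} : ℝ) := by
    obtain ⟨w, hw⟩ := hP
    exact hpos 2 w ((hκ2 w).mpr hw)
  have hq0 : 0 < (Finset.card {i | κ i = 3} : ℝ) := by
    obtain ⟨w, hw⟩ := hQ
    exact hpos 3 w ((hκ3 w).mpr hw)
  obtain ⟨a, ha, haa⟩ : ∃ a : ℝ, 0 < a ∧ a ^ 2 = (Finset.card {i | κ i = 2} : ℝ) :=
    ⟨_, Real.sqrt_pos.mpr hp0, Real.sq_sqrt hp0.le⟩
  obtain ⟨b, hb, hbb⟩ : ∃ b : ℝ, 0 < b ∧ b ^ 2 = (Finset.card {i | κ i = 3} : ℝ) :=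
    ⟨_, Real.sqrt_pos.mpr hq0, Real.sq_sqrt hq0.le⟩
  have hn : ∀ a', (Finset.card {i | κ i = a'} : ℝ) = ![1, 1, a ^ 2, b ^ 2] a' := by
    intro a'
    fin_cases a'
    · simp [hκ0, Finset.filter_eq']
    · simp [hκ1, Finset.filter_eq']
    · simp [haa]
    · simp [hbb]
  obtain ⟨c, hc⟩ : ∃ c, c = a + b := ⟨_, rfl⟩
  have hc0 : 0 < c := by rw [hc]; positivity
  have hc1 : 0 < 1 + c ^ 2 := by positivity
  obtain ⟨τ, hτ0, hτ⟩ : ∃ τ : ℝ, 0 < τ ∧ τ ^ 2 = 1 + c ^ 2 :=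
    ⟨_, Real.sqrt_pos.mpr hc1, Real.sq_sqrt hc1.le⟩
  -- The positive part of the double star. Its biadjacency matrix reduces to `!![1, a; b, 0]`, whose
  -- singular values have sum `τ` and product `a * b`.
  set x : Matrix (Fin 4) (Fin 4) ℝ :=
    !![(1 + a * c) / (2 * τ), 1 / 2, 1 / 2, 1 / (2 * τ);
      1 / 2, (1 + b * c) / (2 * τ), 1 / (2 * τ), 1 / 2;
      1 / 2, 1 / (2 * τ), c / (2 * a * τ), 0;
      1 / (2 * τ), 1 / 2, 0, c / (2 * b * τ)] with hx
  have hxpsd : x.PosSemidef := by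
    have : x = (c / (2 * a * τ)) • vecMulVec ![a * τ / c, a / c, 1, 0] ![a * τ / c, a / c, 1, 0] +
        (c / (2 * b * τ)) • vecMulVec ![b / c, b * τ / c, 0, 1] ![b / c, b * τ / c, 0, 1] := by
      ext i j
      fin_cases i <;> fin_cases j <;> simp [hx] <;> field_simp
      all_goals grind
    rw [this]
    exact (posSemidef_smul_vecMulVec_self (by positivity) _).add
      (posSemidef_smul_vecMulVec_self (by positivity) _)
  have h := le_gain_submatrix (G.adjMatrix ℝ) κ x
    !![0, 1 / 2, 1 / 2, 0; 1 / 2, 0, 0, 1 / 2; 1 / 2, 0, 0, 0; 0, 1 / 2, 0, 0] (fun _ _ => 0)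
    _ hn (by
      intro i j
      have h01 : ∀ i j, κ i = 0 → κ j = 1 → G.Adj i j := by
        intro i j hi hj
        rw [hκ0] at hi
        rw [hκ1] at hj
        rwa [hi, hj]
      have h02 : ∀ i j, κ i = 0 → κ j = 2 → G.Adj i j := by
        intro i j hi hj
        rw [hκ0] at hi
        rw [hκ2] at hj
        exact hi ▸ hj.2
      have h13 : ∀ i j, κ i = 1 → κ j = 3 → G.Adj i j := by
        intro i j hi hj
        rw [hκ1] at hi
        rw [hκ3] at hj
        rw [hi]
        exact (hdom j hj.1 (by rintro rfl; exact hj.2 huv)).resolve_left hj.2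
      have hA := adjMatrix_nonneg (G := G) i j
      have e1 : ∀ a b, (∀ i j, κ i = a → κ j = b → G.Adj i j) → κ i = a → κ j = b →
          G.adjMatrix ℝ i j = 1 := fun a b h hi hj => by simp [h i j hi hj]
      have e2 : ∀ a b, (∀ i j, κ i = a → κ j = b → G.Adj i j) → κ i = b → κ j = a →
          G.adjMatrix ℝ i j = 1 := fun a b h hi hj => by simp [(h j i hj hi).symm]
      have f1 := e1 _ _ h01
      have f2 := e1 _ _ h02
      have f3 := e1 _ _ h13
      have g1 := e2 _ _ h01
      have g2 := e2 _ _ h02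
      have g3 := e2 _ _ h13
      clear e1 e2
      revert f1 f2 f3 g1 g2 g3 hA
      generalize G.adjMatrix ℝ i j = α
      generalize κ i = a'
      generalize κ j = b'
      intro hA f1 f2 f3 g1 g2 g3
      fin_cases a' <;> fin_cases b' <;> simp [hx] at f1 f2 f3 g1 g2 g3 ⊢
      all_goals first | positivity | (subst_vars; norm_num))
  have hcard := card_eq_sum_card_fiber κ _ hn
  refine le_trans ?_ (h.trans (gain_le_posSquareEnergy (hxpsd.submatrix κ)))
  refine le_of_eq ?_
  rw [hcard]
  simp [Fin.sum_univ_four, hx]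
  field_simp
  rw [hτ, hc]
  ring

end SimpleGraph

/-! ### Two nonadjacent centres: the certificate -/

namespace SimpleGraph

open Matrix

variable {V : Type*} [Fintype V] {G : SimpleGraph V} [DecidableRel G.Adj]

/-- The certificate given by the positive part of the bipartite graph that joins two vertices
(blocks `0` and `1`) to their private neighbours (blocks `2` and `3`) and to their common
neighbours (block `4`). -/
theorem exists_gain_of_two_centers (κ : V → Fin 5) {p q r δ τ : ℝ} (hp : 0 ≤ p) (hq : 0 ≤ q)
    (hr : 0 ≤ r) (hn : ∀ a, (Finset.card {i | κ i = a} : ℝ) = ![1, 1, p, q, r] a)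
    (h02 : ∀ i j, κ i = 0 → κ j = 2 → G.Adj i j) (h04 : ∀ i j, κ i = 0 → κ j = 4 → G.Adj i j)
    (h13 : ∀ i j, κ i = 1 → κ j = 3 → G.Adj i j) (h14 : ∀ i j, κ i = 1 → κ j = 4 → G.Adj i j)
    (hδ0 : 0 < δ) (hδ : δ ^ 2 = p * q + r * (p + q)) (hτ0 : 0 < τ)
    (hτ : τ ^ 2 = p + q + 2 * r + 2 * δ) :
    ∃ X : Matrix V V ℝ, X.PosSemidef ∧
      (∀ i j, κ i = 2 → κ j = 2 → X i j = (q + r + δ) / (2 * τ * δ)) ∧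
      (∀ i j, κ i = 3 → κ j = 3 → X i j = (p + r + δ) / (2 * τ * δ)) ∧
      (∀ i j, κ i = 2 → κ j = 3 → X i j = -r / (2 * τ * δ)) ∧
      p + q + 2 * r - 2 * r / (τ * δ) *
        ∑ i, ∑ j, (if κ i = 2 ∧ κ j = 3 then G.adjMatrix ℝ i j else 0) ≤
        gain (G.adjMatrix ℝ) X := by
  -- The Gram matrix of the two centres is `!![p + r, r; r, q + r]`. Its square root has determinant
  -- `δ` and trace `τ`, so by Cayley–Hamilton it is the Gram matrix plus `δ`, divided by `τ`; half
  -- of it is the block of the centres.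
  set x : Matrix (Fin 5) (Fin 5) ℝ :=
    !![(p + r + δ) / (2 * τ), r / (2 * τ), 1 / 2, 0, 1 / 2;
      r / (2 * τ), (q + r + δ) / (2 * τ), 0, 1 / 2, 1 / 2;
      1 / 2, 0, (q + r + δ) / (2 * τ * δ), -r / (2 * τ * δ), (q + δ) / (2 * τ * δ);
      0, 1 / 2, -r / (2 * τ * δ), (p + r + δ) / (2 * τ * δ), (p + δ) / (2 * τ * δ);
      1 / 2, 1 / 2, (q + δ) / (2 * τ * δ), (p + δ) / (2 * τ * δ),
        (p + q + 2 * δ) / (2 * τ * δ)] with hx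
  have hxpsd : x.PosSemidef := by
    set z₁ : Fin 5 → ℝ := ![(p + r + δ) / τ, r / τ, 1, 0, 1] with hz₁
    set z₂ : Fin 5 → ℝ := ![r / τ, (q + r + δ) / τ, 0, 1, 1] with hz₂
    -- The vectors and weights can be read off from blocks 2, 3, 4, where the matrix is a
    -- combination of the squares of `(1, 0, 1)`, `(0, 1, 1)` and `(1, -1, 0)`.
    set z₃ : Fin 5 → ℝ := ![(p + δ) / τ, -(q + δ) / τ, 1, -1, 0] with hz₃
    have : x = ((q + δ) / (2 * τ * δ)) • vecMulVec z₁ z₁ +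
        ((p + δ) / (2 * τ * δ)) • vecMulVec z₂ z₂ + (r / (2 * τ * δ)) • vecMulVec z₃ z₃ := by
      ext i j
      fin_cases i <;> fin_cases j <;> simp [hx, hz₁, hz₂, hz₃] <;> field_simp
      all_goals grind
    rw [this]
    exact ((posSemidef_smul_vecMulVec_self (by positivity) _).add
      (posSemidef_smul_vecMulVec_self (by positivity) _)).add
      (posSemidef_smul_vecMulVec_self (by positivity) _)
  refine ⟨x.submatrix κ κ, hxpsd.submatrix κ, ?_, ?_, ?_, ?_⟩
  · intro i j hi hj
    simp [hi, hj, hx]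
  · intro i j hi hj
    simp [hi, hj, hx]
  · intro i j hi hj
    simp [hi, hj, hx]
  have h := le_gain_submatrix (G.adjMatrix ℝ) κ x
    !![0, 0, 1 / 2, 0, 1 / 2; 0, 0, 0, 1 / 2, 1 / 2; 1 / 2, 0, 0, 0, 0; 0, 1 / 2, 0, 0, 0;
      1 / 2, 1 / 2, 0, 0, 0]
    (fun i j => -r / (2 * τ * δ) * ((if κ i = 2 ∧ κ j = 3 then G.adjMatrix ℝ i j else 0) +
      if κ j = 2 ∧ κ i = 3 then G.adjMatrix ℝ j i else 0)) _ hn (by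
      intro i j
      have hA := adjMatrix_nonneg (G := G) i j
      have hAs : G.adjMatrix ℝ j i = G.adjMatrix ℝ i j := by simp [G.adj_comm]
      have e1 : ∀ a b, (∀ i j, κ i = a → κ j = b → G.Adj i j) → κ i = a → κ j = b →
          G.adjMatrix ℝ i j = 1 := fun a b h hi hj => by simp [h i j hi hj]
      have e2 : ∀ a b, (∀ i j, κ i = a → κ j = b → G.Adj i j) → κ i = b → κ j = a →
          G.adjMatrix ℝ i j = 1 := fun a b h hi hj => by simp [(h j i hj hi).symm]
      have f1 := e1 _ _ h02
      have f2 := e1 _ _ h04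
      have f3 := e1 _ _ h13
      have f4 := e1 _ _ h14
      have g1 := e2 _ _ h02
      have g2 := e2 _ _ h04
      have g3 := e2 _ _ h13
      have g4 := e2 _ _ h14
      clear e1 e2
      rw [hAs]
      revert f1 f2 f3 f4 g1 g2 g3 g4 hA
      generalize G.adjMatrix ℝ i j = α
      generalize κ i = a'
      generalize κ j = b'
      intro hA f1 f2 f3 f4 g1 g2 g3 g4
      fin_cases a' <;> fin_cases b' <;> simp [hx] at f1 f2 f3 f4 g1 g2 g3 g4 ⊢
      all_goals first | positivity | (subst_vars; norm_num; done) | exact le_of_eq (by ring))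
  have hsum : ∑ i, ∑ j, -r / (2 * τ * δ) *
      ((if κ i = 2 ∧ κ j = 3 then G.adjMatrix ℝ i j else 0) +
      if κ j = 2 ∧ κ i = 3 then G.adjMatrix ℝ j i else 0) = -r / (τ * δ) *
      ∑ i, ∑ j, (if κ i = 2 ∧ κ j = 3 then G.adjMatrix ℝ i j else 0) := by
    simp only [← Finset.mul_sum, Finset.sum_add_distrib]
    rw [Finset.sum_comm (f := fun i j => if κ j = 2 ∧ κ i = 3 then G.adjMatrix ℝ j i else 0)]
    field_simp
    ring
  rw [hsum] at h
  refine le_trans (le_of_eq ?_) h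
  have hmain : ∑ a, ∑ a', ![1, 1, p, q, r] a * ![1, 1, p, q, r] a' *
      (2 * !![0, 0, 1 / 2, 0, 1 / 2; 0, 0, 0, 1 / 2, 1 / 2; 1 / 2, 0, 0, 0, 0; 0, 1 / 2, 0, 0, 0;
      1 / 2, 1 / 2, 0, 0, 0] a a' - x a a' ^ 2) = p + q + 2 * r := by
    have k1 : (p + r + δ) ^ 2 + (q + r + δ) ^ 2 + 2 * r ^ 2 = τ ^ 2 * (p + q + 2 * r) := by
      grind
    have k2 : p ^ 2 * (q + r + δ) ^ 2 + q ^ 2 * (p + r + δ) ^ 2 + 2 * p * q * r ^ 2 +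
        2 * p * r * (q + δ) ^ 2 + 2 * q * r * (p + δ) ^ 2 + r ^ 2 * (p + q + 2 * δ) ^ 2 =
        τ ^ 2 * δ ^ 2 * (p + q + 2 * r) := by
      grind
    simp [Fin.sum_univ_five, hx]
    field_simp
    linear_combination -(δ ^ 2) * k1 - k2
  rw [hmain]
  ring

end SimpleGraph

/-! ### Numerical estimates for the loss at the negative entries -/

/-- This bounds the loss `2re / (τδ)` by `r / 2`. With `a = √e`, the inequality of the means gives
`p + q ≥ 2a`, and then `δ` and `τ` are bounded below in terms of `a ≥ 1`. -/
theorem four_mul_le_mul_of_sq_eq {p q r e δ τ : ℝ} (hp : 0 ≤ p) (hq : 0 ≤ q)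
    (he1 : 1 ≤ e) (her : e ≤ r) (hepq : e ≤ p * q) (hδ0 : 0 < δ)
    (hδ : δ ^ 2 = p * q + r * (p + q)) (hτ0 : 0 < τ) (hτ : τ ^ 2 = p + q + 2 * r + 2 * δ) :
    4 * e ≤ τ * δ := by
  obtain ⟨a, ha0, ha⟩ : ∃ a : ℝ, 0 ≤ a ∧ a ^ 2 = e :=
    ⟨_, Real.sqrt_nonneg e, Real.sq_sqrt (by linarith)⟩
  subst ha
  have ha1 : 1 ≤ a := by nlinarith
  have hpq : 2 * a ≤ p + q := by
    apply le_of_sq_le_sq _ (by positivity)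
    nlinarith [sq_nonneg (p - q)]
  have hra : a ≤ r := by nlinarith
  have hr0 : 0 ≤ r := ha0.trans hra
  have h1 : a ^ 2 + 2 * a ^ 3 ≤ δ ^ 2 := by
    have : a ^ 2 * (2 * a) ≤ r * (p + q) := by gcongr
    nlinarith
  have h2 : 17 / 10 * a ≤ δ := by
    apply le_of_sq_le_sq _ hδ0.le
    nlinarith [mul_nonneg (sq_nonneg a) (sub_nonneg.mpr ha1)]
  have h3 : 2 * a ^ 2 + 27 / 5 * a ≤ τ ^ 2 := by nlinarith
  apply le_of_sq_le_sq _ (by positivity)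
  calc (4 * a ^ 2) ^ 2 ≤ (2 * a ^ 2 + 27 / 5 * a) * (a ^ 2 + 2 * a ^ 3) := by
        have : 0 ≤ a ^ 3 * (4 * a ^ 2 - 16 / 5 * a + 27 / 5) := by
          apply mul_nonneg (by positivity)
          nlinarith [sq_nonneg (2 * a - 1)]
        nlinarith
    _ ≤ τ ^ 2 * δ ^ 2 := by gcongr
    _ = (τ * δ) ^ 2 := by ring

/-- The case `r = e = 1`: improving along the only edge between the private neighbourhoods repays
its loss `2 / (τδ)`. Numerically, `t ≥ 7 / 10` while `2 / (τδ) ≤ 49 / 100`. -/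
theorem exists_edge_weight_of_sq_eq {p q δ τ : ℝ} (hp : 1 ≤ p) (hq : 1 ≤ q) (hδ0 : 0 < δ)
    (hδ : δ ^ 2 = p * q + (p + q)) (hτ0 : 0 < τ) (hτ : τ ^ 2 = p + q + 2 + 2 * δ) :
    ∃ t : ℝ, 0 ≤ t ∧ (p + q + 2 * δ) / (2 * τ * δ) = 2 - 2 * t ∧ 2 / (τ * δ) ≤ t ^ 2 := by
  have hτδ : 0 < τ * δ := by positivity
  have hδ3 : 3 ≤ δ ^ 2 := by nlinarith
  have hδ1 : 17 / 10 ≤ δ := by nlinarith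
  have h1 : 21 / 5 ≤ τ * δ := by
    apply le_of_sq_le_sq _ hτδ.le
    rw [mul_pow]
    have : 7 ≤ τ ^ 2 := by nlinarith
    nlinarith
  -- From `(p - 1) * (q - 1) ≥ 0`, that is, `δ ^ 2 ≥ 2 * (p + q) - 1`.
  have hy : p + q + 2 * δ ≤ δ ^ 2 / 2 + 2 * δ + 1 / 2 := by
    nlinarith [mul_nonneg (sub_nonneg.mpr hp) (sub_nonneg.mpr hq)]
  have h2 : p + q + 2 * δ ≤ 6 / 5 * (τ * δ) := by
    apply le_of_sq_le_sq _ (by positivity)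
    have e1 : (6 / 5 * (τ * δ)) ^ 2 = 36 / 25 * (p + q + 2 * δ + 2) * δ ^ 2 := by
      rw [mul_pow, mul_pow, hτ]; ring
    rw [e1]
    have hy0 : 0 ≤ p + q + 2 * δ := by positivity
    generalize p + q + 2 * δ = y at hy hy0
    set Y := δ ^ 2 / 2 + 2 * δ + 1 / 2 with hY
    have hYY : Y * Y ≤ 36 / 25 * (Y + 2) * δ ^ 2 := by
      have : 0 ≤ 47 * δ ^ 4 + 88 * δ ^ 3 - 90 * δ ^ 2 - 200 * δ - 25 := by
        have a1 : 0 ≤ δ ^ 2 * (δ ^ 2 - 3) := by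
          apply mul_nonneg (by positivity); linarith
        have a2 : 0 ≤ δ * (δ ^ 2 - 3) := by
          apply mul_nonneg (by positivity); linarith
        nlinarith
      rw [hY]
      nlinarith
    -- The left side is linear in `y`, so only the endpoint `y = Y` matters, and that is `hYY`.
    have h3 : (Y - 36 / 25 * δ ^ 2) * y ≤ 72 / 25 * δ ^ 2 := by
      rcases le_total (Y - 36 / 25 * δ ^ 2) 0 with h | h
      · have := mul_nonneg (neg_nonneg.mpr h) hy0
        nlinarith [sq_nonneg δ]
      · have := mul_le_mul_of_nonneg_left hy h
        nlinarith
    have h4 := mul_le_mul_of_nonneg_left hy hy0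
    nlinarith
  have h5 : (p + q + 2 * δ) / (4 * (τ * δ)) ≤ 3 / 10 := by
    rw [div_le_iff₀ (by positivity)]
    linarith
  refine ⟨1 - (p + q + 2 * δ) / (4 * (τ * δ)), by linarith, by field_simp; ring, ?_⟩
  have h6 : 2 / (τ * δ) ≤ 49 / 100 := by
    rw [div_le_iff₀ hτδ]
    linarith
  nlinarith

/-! ### Assembling the bounds -/

namespace SimpleGraph

open Matrix

variable {V : Type*} [Fintype V] [DecidableEq V] {G : SimpleGraph V} [DecidableRel G.Adj]

theorem IsDominatingVertex.card_sub_one_le {v : V} (hv : G.IsDominatingVertex v) :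
    (Fintype.card V : ℝ) - 1 ≤ G.posSquareEnergy := by
  have h := (hasGain_star (G := G) (v := v) (S := Finset.univ.erase v) (by simp)
    (fun w hw => hv w (Finset.ne_of_mem_erase hw))).le_posSquareEnergy
  rwa [Finset.cast_card_erase_of_mem (Finset.mem_univ v), Finset.card_univ] at h

theorem IsDominatingVertex.card_le {v : V} (hv : G.IsDominatingVertex v) {x y : V} (hx : x ≠ v)
    (hy : y ≠ v) (hxy : G.Adj x y) : (Fintype.card V : ℝ) ≤ G.posSquareEnergy := by
  have h := (hasGain_star_of_adj (G := G) (v := v) (S := Finset.univ.erase v) (by simp)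
    (fun w hw => hv w (Finset.ne_of_mem_erase hw)) (by simpa using hx) (by simpa using hy)
    hxy).le_posSquareEnergy
  rwa [Finset.cast_card_erase_of_mem (Finset.mem_univ v), Finset.card_univ, sub_add_cancel] at h

theorem IsDominatingVertex.nonempty_iso_star {V : Type*} [Fintype V] [DecidableEq V]
    {G : SimpleGraph V} {v : V} (hv : G.IsDominatingVertex v)
    (h : ∀ x y, x ≠ v → y ≠ v → ¬ G.Adj x y) :
    Nonempty (G ≃g completeBipartiteGraph (Fin 1) (Fin (Fintype.card V - 1))) := by
  have e₁ : {x // x = v} ≃ Fin 1 := Fintype.equivFinOfCardEq (by simp)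
  have e₂ : {x // ¬ x = v} ≃ Fin (Fintype.card V - 1) :=
    Fintype.equivFinOfCardEq (by simp [Fintype.card_subtype_compl])
  refine ⟨RelIso.symm ⟨(e₁.symm.sumCongr e₂.symm).trans (Equiv.sumCompl (· = v)), ?_⟩⟩
  rintro (a | a) (b | b)
  · simp [(e₁.symm a).2, (e₁.symm b).2]
  · simpa [(e₁.symm a).2] using hv _ (e₂.symm b).2
  · simpa [(e₁.symm b).2] using (hv _ (e₂.symm a).2).symm
  · simpa using h _ _ (e₂.symm a).2 (e₂.symm b).2

/-- The bound for a graph dominated by two adjacent vertices. -/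
theorem card_sub_one_le_of_adj_of_dominating {u v : V} (huv : G.Adj u v)
    (hdom : ∀ w, w ≠ u → w ≠ v → G.Adj u w ∨ G.Adj v w) :
    (Fintype.card V : ℝ) - 1 ≤ G.posSquareEnergy := by
  by_cases hP : ∃ w, w ≠ v ∧ G.Adj u w
  · by_cases hQ : ∃ w, w ≠ u ∧ ¬ G.Adj u w
    · exact card_sub_one_le_of_adj huv hdom hP hQ
    · push Not at hQ
      exact IsDominatingVertex.card_sub_one_le (v := u) hQ
  · push Not at hP
    refine IsDominatingVertex.card_sub_one_le (v := v) fun w hw => ?_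
    by_cases hwu : w = u
    · exact hwu ▸ huv.symm
    · exact (hdom w hwu hw).resolve_left (hP w hw)

/-- The lower bound that comes from the bipartite subgraph induced on two vertices (blocks `0`
and `1`) and their private neighbours (blocks `2` and `3`). -/
theorem private_neighbors_bipartite_le (κ : V → Fin 5) {p q r : ℝ}
    (hn : ∀ a, (Finset.card {i | κ i = a} : ℝ) = ![1, 1, p, q, r] a)
    (h02 : ∀ i j, κ i = 0 → κ j = 2 → G.Adj i j) (h13 : ∀ i j, κ i = 1 → κ j = 3 → G.Adj i j)
    (h00 : ∀ i j, κ i = 0 → κ j = 0 → ¬ G.Adj i j) (h11 : ∀ i j, κ i = 1 → κ j = 1 → ¬ G.Adj i j)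
    (h22 : ∀ i j, κ i = 2 → κ j = 2 → ¬ G.Adj i j) (h33 : ∀ i j, κ i = 3 → κ j = 3 → ¬ G.Adj i j)
    (h03 : ∀ i j, κ i = 0 → κ j = 3 → ¬ G.Adj i j)
    (h12 : ∀ i j, κ i = 1 → κ j = 2 → ¬ G.Adj i j) :
    p + q + ∑ i, ∑ j, (if κ i = 2 ∧ κ j = 3 then G.adjMatrix ℝ i j else 0) ≤
      G.posSquareEnergy := by
  have hbip := (hasGain_of_bipartite (G := G) {i | κ i ≠ 4}
    -- The colour classes are blocks 0 and 3 against blocks 1 and 2; block 4 is left out.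
    (fun i => ![1, -1, -1, 1, 1] (κ i)) (by
      intro i
      generalize κ i = a
      fin_cases a <;> simp) (by
      intro i hi j hj hij
      simp only [Finset.mem_filter, Finset.mem_univ, true_and] at hi hj
      have n00 : ¬ (κ i = 0 ∧ κ j = 0) := fun ⟨h1, h2⟩ => h00 i j h1 h2 hij
      have n11 : ¬ (κ i = 1 ∧ κ j = 1) := fun ⟨h1, h2⟩ => h11 i j h1 h2 hij
      have n22 : ¬ (κ i = 2 ∧ κ j = 2) := fun ⟨h1, h2⟩ => h22 i j h1 h2 hij
      have n33 : ¬ (κ i = 3 ∧ κ j = 3) := fun ⟨h1, h2⟩ => h33 i j h1 h2 hij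
      have n03 : ¬ (κ i = 0 ∧ κ j = 3) := fun ⟨h1, h2⟩ => h03 i j h1 h2 hij
      have n30 : ¬ (κ i = 3 ∧ κ j = 0) := fun ⟨h1, h2⟩ => h03 j i h2 h1 hij.symm
      have n12 : ¬ (κ i = 1 ∧ κ j = 2) := fun ⟨h1, h2⟩ => h12 i j h1 h2 hij
      have n21 : ¬ (κ i = 2 ∧ κ j = 1) := fun ⟨h1, h2⟩ => h12 j i h2 h1 hij.symm
      clear h00 h11 h22 h33 h03 h12 h02 h13 hij hn
      generalize κ i = a at *
      generalize κ j = b at *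
      fin_cases a <;> fin_cases b <;> simp at *)).le_posSquareEnergy
  refine le_trans ?_ hbip
  set W : Matrix (Fin 5) (Fin 5) ℝ :=
    !![0, 0, 1, 0, 0; 0, 0, 0, 1, 0; 1, 0, 0, 0, 0; 0, 1, 0, 0, 0; 0, 0, 0, 0, 0] with hW
  have hle : ∑ i, ∑ j, (W (κ i) (κ j) +
      ((if κ i = 2 ∧ κ j = 3 then G.adjMatrix ℝ i j else 0) +
        if κ j = 2 ∧ κ i = 3 then G.adjMatrix ℝ j i else 0)) ≤
      ∑ i with κ i ≠ 4, ∑ j with κ j ≠ 4, G.adjMatrix ℝ i j := by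
    rw [Finset.sum_filter]
    refine Finset.sum_le_sum fun i _ => ?_
    have hz : (if κ i ≠ 4 then ∑ j with κ j ≠ 4, G.adjMatrix ℝ i j else 0) =
        ∑ j, if κ i ≠ 4 ∧ κ j ≠ 4 then G.adjMatrix ℝ i j else 0 := by
      by_cases hi : κ i = 4
      · simp [hi]
      · rw [if_pos hi, Finset.sum_filter]
        refine Finset.sum_congr rfl fun j _ => ?_
        simp only [ne_eq, hi, not_false_eq_true, true_and]
    rw [hz]
    refine Finset.sum_le_sum fun j _ => ?_
    have hA := adjMatrix_nonneg (G := G) i j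
    have hAs : G.adjMatrix ℝ j i = G.adjMatrix ℝ i j := by simp [G.adj_comm]
    have f1 : κ i = 0 → κ j = 2 → G.adjMatrix ℝ i j = 1 := fun hi hj => by
      simp [h02 i j hi hj]
    have f2 : κ i = 2 → κ j = 0 → G.adjMatrix ℝ i j = 1 := fun hi hj => by
      simp [(h02 j i hj hi).symm]
    have f3 : κ i = 1 → κ j = 3 → G.adjMatrix ℝ i j = 1 := fun hi hj => by
      simp [h13 i j hi hj]
    have f4 : κ i = 3 → κ j = 1 → G.adjMatrix ℝ i j = 1 := fun hi hj => by
      simp [(h13 j i hj hi).symm]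
    rw [hAs]
    revert f1 f2 f3 f4 hA
    generalize G.adjMatrix ℝ i j = α
    generalize κ i = a
    generalize κ j = b
    intro hA f1 f2 f3 f4
    fin_cases a <;> fin_cases b <;> simp [hW] at f1 f2 f3 f4 ⊢
    all_goals first | assumption | exact f1.ge | exact f2.ge | exact f3.ge | exact f4.ge
  simp only [Finset.sum_add_distrib] at hle
  rw [Finset.sum_comm (f := fun i j => if κ j = 2 ∧ κ i = 3 then G.adjMatrix ℝ j i else 0),
    sum_sum_comp κ _ hn fun a b => W a b] at hle
  simp only [Fin.sum_univ_five, hW] at hle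
  simp [-adjMatrix_apply] at hle ⊢
  linarith

/-- The bound for a connected graph dominated by two nonadjacent vertices, each of which has a
neighbour that is not adjacent to the other one. -/
theorem card_sub_one_le_of_not_adj (hG : G.Connected) {u v : V} (hne : u ≠ v)
    (huv : ¬ G.Adj u v) (hdom : ∀ w, w ≠ u → w ≠ v → G.Adj u w ∨ G.Adj v w)
    (hP : ∃ w, G.Adj u w ∧ ¬ G.Adj v w) (hQ : ∃ w, G.Adj v w ∧ ¬ G.Adj u w) :
    (Fintype.card V : ℝ) - 1 ≤ G.posSquareEnergy := by
  set κ : V → Fin 5 := fun i => if i = u then 0 else if i = v then 1 else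
    if G.Adj u i then if G.Adj v i then 4 else 2 else 3 with hκ
  have hvu : ¬ G.Adj v u := fun h => huv h.symm
  have hκ0 : ∀ i, κ i = 0 ↔ i = u := by
    intro i
    simp only [hκ]
    split_ifs <;> simp_all
  have hκ1 : ∀ i, κ i = 1 ↔ i = v := by
    intro i
    simp only [hκ]
    split_ifs <;> simp_all
  have hκ2 : ∀ i, κ i = 2 ↔ G.Adj u i ∧ ¬ G.Adj v i := by
    intro i
    simp only [hκ]
    split_ifs <;> simp_all
  have hκ3 : ∀ i, κ i = 3 ↔ G.Adj v i ∧ ¬ G.Adj u i := by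
    intro i
    have := hdom i
    simp only [hκ]
    split_ifs <;> simp_all
  have hκ4 : ∀ i, κ i = 4 ↔ G.Adj u i ∧ G.Adj v i := by
    intro i
    simp only [hκ]
    split_ifs <;> simp_all
  have h02 : ∀ i j, κ i = 0 → κ j = 2 → G.Adj i j := fun i j hi hj =>
    (hκ0 i).mp hi ▸ ((hκ2 j).mp hj).1
  have h04 : ∀ i j, κ i = 0 → κ j = 4 → G.Adj i j := fun i j hi hj =>
    (hκ0 i).mp hi ▸ ((hκ4 j).mp hj).1
  have h13 : ∀ i j, κ i = 1 → κ j = 3 → G.Adj i j := fun i j hi hj =>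
    (hκ1 i).mp hi ▸ ((hκ3 j).mp hj).1
  have h14 : ∀ i j, κ i = 1 → κ j = 4 → G.Adj i j := fun i j hi hj =>
    (hκ1 i).mp hi ▸ ((hκ4 j).mp hj).2
  obtain ⟨p, hp⟩ : ∃ p : ℕ, p = Finset.card {i | κ i = 2} := ⟨_, rfl⟩
  obtain ⟨q, hq⟩ : ∃ q : ℕ, q = Finset.card {i | κ i = 3} := ⟨_, rfl⟩
  obtain ⟨r, hr⟩ : ∃ r : ℕ, r = Finset.card {i | κ i = 4} := ⟨_, rfl⟩
  have hp1 : 1 ≤ p := by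
    obtain ⟨w, hw⟩ := hP
    exact hp ▸ Finset.card_pos.mpr ⟨w, by simpa [hκ2] using hw⟩
  have hq1 : 1 ≤ q := by
    obtain ⟨w, hw⟩ := hQ
    exact hq ▸ Finset.card_pos.mpr ⟨w, by simpa [hκ3] using hw⟩
  have hn : ∀ a, (Finset.card {i | κ i = a} : ℝ) = ![1, 1, (p : ℝ), q, r] a := by
    intro a
    fin_cases a
    · simp [hκ0, Finset.filter_eq']
    · simp [hκ1, Finset.filter_eq']
    · simp [hp]
    · simp [hq]
    · simp [hr]
  have hcard : (Fintype.card V : ℝ) - 1 = p + q + r + 1 := by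
    rw [card_eq_sum_card_fiber κ _ hn]
    simp [Fin.sum_univ_five]
    ring
  rw [hcard]
  have hfilter : ∀ a : Fin 5, a ≠ 4 → Finset.card {i | κ i = a ∨ κ i = 4} =
      Finset.card {i | κ i = a} + Finset.card {i | κ i = 4} := by
    intro a ha
    rw [Finset.filter_or, Finset.card_union_of_disjoint]
    rw [Finset.disjoint_filter]
    intro i _ hi hi'
    exact ha (hi.symm.trans hi')
  by_cases h22 : ∃ x y, κ x = 2 ∧ κ y = 2 ∧ G.Adj x y
  · obtain ⟨x, y, hx, hy, hxy⟩ := h22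
    -- The star at `u` takes all common neighbours and gives `p + r + 1`; the star at `v` on its
    -- private neighbours gives `q`.
    have h1 : G.HasGain _ _ := hasGain_star_of_adj (v := u) (S := {i | κ i = 2 ∨ κ i = 4})
      (by simp [hκ2, hκ4]) (by simp +contextual [hκ2, hκ4, or_imp]) (by simp [hx])
      (by simp [hy]) hxy
    have h2 : G.HasGain _ _ := hasGain_star (v := v) (S := {i | κ i = 3}) (by simp [hκ3])
      (by simp +contextual [hκ3])
    have h := (h1.union h2 (by
      rw [Finset.disjoint_left]
      intro i hi hi'
      simp only [Finset.mem_insert, Finset.mem_filter, Finset.mem_univ, true_and, ← hκ0,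
        ← hκ1] at hi hi'
      generalize κ i = a at hi hi'
      fin_cases a <;> simp at hi hi')).le_posSquareEnergy
    rw [hfilter 2 (by decide), ← hp, ← hq, ← hr] at h
    push_cast at h
    linarith
  by_cases h33 : ∃ x y, κ x = 3 ∧ κ y = 3 ∧ G.Adj x y
  · obtain ⟨x, y, hx, hy, hxy⟩ := h33
    have h1 : G.HasGain _ _ := hasGain_star_of_adj (v := v) (S := {i | κ i = 3 ∨ κ i = 4})
      (by simp [hκ3, hκ4]) (by simp +contextual [hκ3, hκ4, or_imp]) (by simp [hx])
      (by simp [hy]) hxy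
    have h2 : G.HasGain _ _ := hasGain_star (v := u) (S := {i | κ i = 2}) (by simp [hκ2])
      (by simp +contextual [hκ2])
    have h := (h1.union h2 (by
      rw [Finset.disjoint_left]
      intro i hi hi'
      simp only [Finset.mem_insert, Finset.mem_filter, Finset.mem_univ, true_and, ← hκ0,
        ← hκ1] at hi hi'
      generalize κ i = a at hi hi'
      fin_cases a <;> simp at hi hi')).le_posSquareEnergy
    rw [hfilter 3 (by decide), ← hp, ← hq, ← hr] at h
    push_cast at h
    linarith
  push Not at h22 h33
  set E : Finset (V × V) := {a | κ a.1 = 2 ∧ κ a.2 = 3 ∧ G.Adj a.1 a.2} with hE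
  have hEsum : ∑ i, ∑ j, (if κ i = 2 ∧ κ j = 3 then G.adjMatrix ℝ i j else 0) = E.card := by
    rw [← Fintype.sum_prod_type' fun i j => if κ i = 2 ∧ κ j = 3 then G.adjMatrix ℝ i j else 0,
      hE, Finset.card_filter]
    push_cast
    refine Finset.sum_congr rfl fun a _ => ?_
    simp only [adjMatrix_apply, ← ite_and, and_assoc]
  by_cases hEr : r + 1 ≤ E.card
  · have hle := private_neighbors_bipartite_le κ hn h02 h13
      (fun i j hi hj h => h.ne (((hκ0 i).mp hi).trans ((hκ0 j).mp hj).symm))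
      (fun i j hi hj h => h.ne (((hκ1 i).mp hi).trans ((hκ1 j).mp hj).symm)) h22 h33
      (fun i j hi hj h => ((hκ3 j).mp hj).2 ((hκ0 i).mp hi ▸ h))
      (fun i j hi hj h => ((hκ2 j).mp hj).2 ((hκ1 i).mp hi ▸ h))
    rw [hEsum] at hle
    have hEr' : (r : ℝ) + 1 ≤ E.card := by exact_mod_cast hEr
    linarith
  push Not at hEr
  have hEpq : E.card ≤ p * q := by
    rw [hp, hq, ← Finset.card_product]
    refine Finset.card_le_card fun a ha => ?_
    simp only [hE, Finset.mem_filter, Finset.mem_univ, true_and] at ha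
    simp [ha.1, ha.2.1]
  -- A walk from `u` to `v` must leave `u` and its private neighbours. Without common neighbours it
  -- can do so only along an edge of `E`, but `hEr` makes `E` empty when `r = 0`.
  have hr1 : 1 ≤ r := by
    by_contra hr0
    obtain ⟨w⟩ := hG.preconnected u v
    obtain ⟨d, -, hd1, hd2⟩ := w.exists_boundary_dart {i | κ i = 0 ∨ κ i = 2}
      (by simp [hκ0]) (by simp [hκ0, hκ2, hne.symm, huv])
    simp only [Set.mem_ofPred_eq, not_or] at hd1 hd2
    have hd4 : κ d.snd ≠ 4 := fun h => hr0 (hr ▸ Finset.card_pos.mpr ⟨d.snd, by simpa using h⟩)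
    have hd := d.adj
    have hd13 : κ d.snd = 1 ∨ κ d.snd = 3 := by
      revert hd2 hd4
      generalize κ d.snd = a
      revert a
      decide
    rcases hd1 with h1 | h1 <;> rcases hd13 with h2 | h2
    · exact huv ((hκ0 _).mp h1 ▸ (hκ1 _).mp h2 ▸ hd)
    · exact ((hκ3 _).mp h2).2 ((hκ0 _).mp h1 ▸ hd)
    · exact ((hκ2 _).mp h1).2 ((hκ1 _).mp h2 ▸ hd.symm)
    · have : 0 < E.card := Finset.card_pos.mpr ⟨d.toProd, by simp [hE, h1, h2, hd]⟩
      omega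
  have hp1' : (1 : ℝ) ≤ p := by exact_mod_cast hp1
  have hq1' : (1 : ℝ) ≤ q := by exact_mod_cast hq1
  have hr1' : (1 : ℝ) ≤ r := by exact_mod_cast hr1
  have hδ' : (0 : ℝ) < p * q + r * (p + q) := by positivity
  obtain ⟨δ, hδ0, hδ⟩ : ∃ δ : ℝ, 0 < δ ∧ δ ^ 2 = p * q + r * (p + q) :=
    ⟨_, Real.sqrt_pos.mpr hδ', Real.sq_sqrt hδ'.le⟩
  have hτ' : (0 : ℝ) < p + q + 2 * r + 2 * δ := by positivity
  obtain ⟨τ, hτ0, hτ⟩ : ∃ τ : ℝ, 0 < τ ∧ τ ^ 2 = p + q + 2 * r + 2 * δ :=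
    ⟨_, Real.sqrt_pos.mpr hτ', Real.sq_sqrt hτ'.le⟩
  obtain ⟨X, hX, hX2, hX3, hX23, hg⟩ := exists_gain_of_two_centers κ (Nat.cast_nonneg p)
    (Nat.cast_nonneg q) (Nat.cast_nonneg r) hn h02 h04 h13 h14 hδ0 hδ hτ0 hτ
  rw [hEsum] at hg
  rcases Nat.eq_zero_or_pos E.card with hE0 | hE0
  · refine le_trans ?_ (hg.trans (gain_le_posSquareEnergy hX))
    rw [hE0]
    simp
    linarith
  rcases Nat.lt_or_ge 1 r with hr2 | hr2
  -- The gain is at least `p + q + 2r - r / 2`, and `r / 2 ≥ 1` leaves the required `p + q + r + 1`.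
  · have h := four_mul_le_mul_of_sq_eq (e := E.card) (Nat.cast_nonneg p) (Nat.cast_nonneg q)
      (by exact_mod_cast hE0) (by exact_mod_cast Nat.lt_succ_iff.mp hEr) (by exact_mod_cast hEpq)
      hδ0 hδ hτ0 hτ
    refine le_trans ?_ (hg.trans (gain_le_posSquareEnergy hX))
    have hr2' : (2 : ℝ) ≤ r := by exact_mod_cast hr2
    have h' : 2 * r / (τ * δ) * E.card ≤ r / 2 := by
      rw [div_mul_eq_mul_div, div_le_iff₀ (by positivity)]
      nlinarith
    linarith
  -- Here `p + q + 2r` equals the target, so the loss has to be recovered in full.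
  · have hr' : r = 1 := le_antisymm hr2 hr1
    have hE1 : E.card = 1 := by omega
    obtain ⟨a, ha⟩ := Finset.card_pos.mp hE0
    simp only [hE, Finset.mem_filter, Finset.mem_univ, true_and] at ha
    rw [hE1, hr'] at hg
    rw [hr'] at hδ hτ hX2 hX3 hX23 ⊢
    obtain ⟨t, ht0, ht, htt⟩ := exists_edge_weight_of_sq_eq hp1' hq1' hδ0
      (by simpa using hδ) hτ0 (by simpa using hτ)
    obtain ⟨Y, hY, -, hYg⟩ := exists_gain_add_edge hX ha.2.2 ht0 (by
      rw [hX2 _ _ ha.1 ha.1, hX3 _ _ ha.2.1 ha.2.1, hX23 _ _ ha.1 ha.2.1, ← ht]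
      field_simp
      push_cast
      ring)
    refine le_trans ?_ (gain_le_posSquareEnergy hY)
    rw [← hYg]
    push_cast at hg ⊢
    rw [mul_one, mul_one] at hg
    linarith

/-- By connectivity `v` has a neighbour `w`, which is also adjacent to `u`. The adjacent pair `u`,
`w` dominates, since `u` reaches everything but `v`. -/
theorem card_sub_one_le_of_neighbors_subset (hG : G.Connected) {u v : V} (hne : u ≠ v)
    (hdom : ∀ w, w ≠ u → w ≠ v → G.Adj u w ∨ G.Adj v w) (hsub : ∀ w, G.Adj v w → G.Adj u w) :
    (Fintype.card V : ℝ) - 1 ≤ G.posSquareEnergy := by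
  obtain ⟨p⟩ := hG.preconnected v u
  obtain ⟨d, -, hd, -⟩ := p.exists_boundary_dart {v} rfl hne
  have hvw : G.Adj v d.snd := (Set.mem_singleton_iff.mp hd) ▸ d.adj
  refine card_sub_one_le_of_adj_of_dominating (hsub _ hvw) fun x hx _ => ?_
  by_cases hxv : x = v
  · exact Or.inr (hxv ▸ hvw.symm)
  · exact Or.inl ((hdom x hx hxv).elim id (hsub x))

/-- The bound for a connected graph dominated by two vertices. -/
theorem card_sub_one_le_of_dominating_pair (hG : G.Connected) {u v : V} (hne : u ≠ v)
    (hdom : ∀ w, w ≠ u → w ≠ v → G.Adj u w ∨ G.Adj v w) :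
    (Fintype.card V : ℝ) - 1 ≤ G.posSquareEnergy := by
  by_cases huv : G.Adj u v
  · exact card_sub_one_le_of_adj_of_dominating huv hdom
  by_cases hQ : ∃ w, G.Adj v w ∧ ¬ G.Adj u w
  · by_cases hP : ∃ w, G.Adj u w ∧ ¬ G.Adj v w
    · exact card_sub_one_le_of_not_adj hG hne huv hdom hP hQ
    · push Not at hP
      exact card_sub_one_le_of_neighbors_subset hG hne.symm (fun w h1 h2 => (hdom w h2 h1).symm) hP
  · push Not at hQ
    exact card_sub_one_le_of_neighbors_subset hG hne hdom hQ

end SimpleGraph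

theorem theorem1p5 {V : Type*} [Fintype V] [DecidableEq V] (G : SimpleGraph V)
    [DecidableRel G.Adj] (hG : G.Connected) :
    ((∃ v, G.IsDominatingVertex v) →
        ¬ Nonempty (G ≃g completeBipartiteGraph (Fin 1) (Fin (Fintype.card V - 1))) →
        (Fintype.card V : ℝ) ≤ G.posSquareEnergy) ∧
      (G.dominationNumber ≤ 2 → (Fintype.card V : ℝ) - 1 ≤ G.posSquareEnergy) := by
  constructor
  · rintro ⟨v, hv⟩ hstar
    by_contra hlt
    exact hstar (hv.nonempty_iso_star fun x y hx hy hxy => hlt (hv.card_le hx hy hxy))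
  · intro hγ
    obtain ⟨D, hD, hDcard⟩ : ∃ D : Finset V, G.IsDominatingSet D ∧ D.card = G.dominationNumber :=
      Nat.sInf_mem (s := {k | ∃ D : Finset V, G.IsDominatingSet D ∧ D.card = k})
        ⟨_, Finset.univ, fun w hw => absurd (Finset.mem_univ w) hw, rfl⟩
    rw [← hDcard] at hγ
    -- An empty dominating set is excluded because a connected graph has a vertex.
    obtain h | h | h : D.card = 0 ∨ D.card = 1 ∨ D.card = 2 := by omega
    · obtain ⟨w⟩ := hG.nonempty
      obtain ⟨v, hv, -⟩ := hD w (by simp [Finset.card_eq_zero.mp h])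
      simp [Finset.card_eq_zero.mp h] at hv
    · obtain ⟨v, rfl⟩ := Finset.card_eq_one.mp h
      exact SimpleGraph.IsDominatingVertex.card_sub_one_le (v := v) fun w hw => by
        simpa using hD w (by simpa using hw)
    · obtain ⟨u, v, hne, rfl⟩ := Finset.card_eq_two.mp h
      exact SimpleGraph.card_sub_one_le_of_dominating_pair hG hne fun w hu hv => by
        simpa using hD w (by simp [hu, hv])
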